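/- For positive integers $m,n,r,s$ let $N(m,n,r,s)$ denote the number of all subgroups of the group $\mathbb{Z}_m\times\mathbb{Z}_n\times\mathbb{Z}_r\times\mathbb{Z}_s$, where $\mathbb{Z}_n$ is the cyclic group of order $n$. Let $\varphi$ be Euler's function, and let $F(k,\ell)$ denote the number of automorphisms of the group $\mathbb{Z}_k\times\mathbb{Z}_\ell$. Then for every prime $p$ and all integers $a,b,c,d\ge 0$, $$N(p^a,p^b,p^c,p^d)=\sum \varphi(p^{x_3})\,\varphi(p^{y_3})\,\varphi(p^{z_3})\,\varphi(p^{t_3})\,F(p^u,p^v),$$ where the (finite) sum is over all 20-tuples $(x_1,\ldots,x_5,y_1,\ldots,y_5,z_1,\ldots,z_5,t_1,\ldots,t_5)$ of nonnegative integers satisfying the following ten conditions: (i) $x_1+x_2+x_3=a$, (ii) $x_3+x_4+x_5=b$, (iii) $y_1+y_2+y_3=\min(x_1,x_4)$, (iv) $y_3+y_4+y_5=x_3+\max(x_1,x_4)$, (v) $z_1+z_2+z_3=c$, (vi) $z_3+z_4+z_5=d$, (vii) $t_1+t_2+t_3=\min(z_1,z_4)$, (viii) $t_3+t_4+t_5=z_3+\max(z_1,z_4)$,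 (ix) $\min(y_2,y_5)=\min(t_2,t_5)=:u$, (x) $y_3+\max(y_2,y_5)=t_3+\max(t_2,t_5)=:v$. -/

import Mathlib

open scoped Nat

/-- The number `N(m, n, r, s)` of all subgroups of `ℤ_m × ℤ_n × ℤ_r × ℤ_s`. -/
noncomputable def numSubgroups (m n r s : ℕ) : ℕ :=
  Nat.card (AddSubgroup (ZMod m × ZMod n × ZMod r × ZMod s))

/-- The number `F(u, v)` of automorphisms of the group `ℤ_u × ℤ_v`. -/
noncomputable def numAut (u v : ℕ) : ℕ :=
  Nat.card ((ZMod u × ZMod v) ≃+ (ZMod u × ZMod v))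

/-- Quintuples `(c₁, c₂, c₃, c₄, c₅)` of nonnegative integers. -/
@[ext]
structure Quint where
  c₁ : ℕ
  c₂ : ℕ
  c₃ : ℕ
  c₄ : ℕ
  c₅ : ℕ

/-- The ten conditions on the twenty nonnegative integers
`x₁, …, x₅, y₁, …, y₅, z₁, …, z₅, t₁, …, t₅`. -/
def Admissible (a b c d : ℕ) (x y z t : Quint) : Prop :=
  x.c₁ + x.c₂ + x.c₃ = a ∧
  x.c₃ + x.c₄ + x.c₅ = b ∧
  y.c₁ + y.c₂ + y.c₃ = min x.c₁ x.c₄ ∧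
  y.c₃ + y.c₄ + y.c₅ = x.c₃ + max x.c₁ x.c₄ ∧
  z.c₁ + z.c₂ + z.c₃ = c ∧
  z.c₃ + z.c₄ + z.c₅ = d ∧
  t.c₁ + t.c₂ + t.c₃ = min z.c₁ z.c₄ ∧
  t.c₃ + t.c₄ + t.c₅ = z.c₃ + max z.c₁ z.c₄ ∧
  min y.c₂ y.c₅ = min t.c₂ t.c₅ ∧
  y.c₃ + max y.c₂ y.c₅ = t.c₃ + max t.c₂ t.c₅

/-- The set of all 20-tuples, written as `(x, y, z, t)` with `x`, `y`, `z`, `t` quintuples,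
over which the sum is taken. -/
def admissibleTuples (a b c d : ℕ) : Set (Quint × Quint × Quint × Quint) :=
  {q | Admissible a b c d q.1 q.2.1 q.2.2.1 q.2.2.2}

/-- The summand `φ(p^{x₃}) φ(p^{y₃}) φ(p^{z₃}) φ(p^{t₃}) F(p^u, p^v)`, where
`u = min(y₂, y₅)` and `v = y₃ + max(y₂, y₅)`. -/
noncomputable def summand (p : ℕ) (x y z t : Quint) : ℕ :=
  φ (p ^ x.c₃) * φ (p ^ y.c₃) * φ (p ^ z.c₃) * φ (p ^ t.c₃) *
    numAut (p ^ min y.c₂ y.c₅) (p ^ (y.c₃ + max y.c₂ y.c₅))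

/-! ### Goursat's lemma -/

section Goursat

variable {G H : Type*} [AddCommGroup G] [AddCommGroup H]

/-- The homomorphism `(a, c) ↦ e [a] - [c]` whose kernel is the fibre product attached to an
isomorphism `e : A ⧸ B ≃+ C ⧸ D`. -/
def goursatHom {A : AddSubgroup G} {B : AddSubgroup A} {C : AddSubgroup H} {D : AddSubgroup C}
    (e : (A ⧸ B) ≃+ (C ⧸ D)) : A × C →+ C ⧸ D :=
  (e.toAddMonoidHom.comp (QuotientAddGroup.mk' B)).comp (AddMonoidHom.fst A C) -
    (QuotientAddGroup.mk' D).comp (AddMonoidHom.snd A C)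

/-- The subgroup of `G × H` attached to an isomorphism `e : A ⧸ B ≃+ C ⧸ D` of subquotients. -/
def goursatSubgroup {A : AddSubgroup G} {B : AddSubgroup A} {C : AddSubgroup H} {D : AddSubgroup C}
    (e : (A ⧸ B) ≃+ (C ⧸ D)) : AddSubgroup (G × H) :=
  (goursatHom e).ker.map (A.subtype.prodMap C.subtype)

section

variable {A : AddSubgroup G} {B : AddSubgroup A} {C : AddSubgroup H} {D : AddSubgroup C}
  (e : (A ⧸ B) ≃+ (C ⧸ D))

theorem mem_goursatSubgroup {g : G} {h : H} :
    (g, h) ∈ goursatSubgroup e ↔ ∃ (hg : g ∈ A) (hh : h ∈ C),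
      e (QuotientAddGroup.mk ⟨g, hg⟩) = QuotientAddGroup.mk ⟨h, hh⟩ := by
  simp only [goursatSubgroup, AddSubgroup.mem_map, AddMonoidHom.mem_ker, Prod.exists]
  constructor
  · rintro ⟨⟨a, ha⟩, ⟨c, hc⟩, hac, heq⟩
    simp only [AddMonoidHom.prodMap, AddMonoidHom.prod_apply, Prod.mk.injEq] at heq
    obtain ⟨rfl, rfl⟩ := heq
    exact ⟨ha, hc, sub_eq_zero.1 hac⟩
  · rintro ⟨hg, hh, heq⟩
    exact ⟨⟨g, hg⟩, ⟨h, hh⟩, sub_eq_zero.2 heq, rfl⟩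

/-- The two projections and the two intersections with the axes recover `A`, `C`, `B`, `D` from the
subgroup; this gives injectivity in Goursat's lemma. -/
theorem exists_mem_goursatSubgroup_fst {g : G} :
    (∃ h, (g, h) ∈ goursatSubgroup e) ↔ g ∈ A := by
  simp only [mem_goursatSubgroup]
  constructor
  · rintro ⟨_, hg, _⟩
    exact hg
  · intro hg
    obtain ⟨⟨h, hh⟩, hq⟩ := QuotientAddGroup.mk_surjective (e (QuotientAddGroup.mk ⟨g, hg⟩))
    exact ⟨h, hg, hh, hq.symm⟩

theorem exists_mem_goursatSubgroup_snd {h : H} :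
    (∃ g, (g, h) ∈ goursatSubgroup e) ↔ h ∈ C := by
  simp only [mem_goursatSubgroup]
  constructor
  · rintro ⟨_, _, hh, _⟩
    exact hh
  · intro hh
    obtain ⟨⟨g, hg⟩, hq⟩ := QuotientAddGroup.mk_surjective (e.symm (QuotientAddGroup.mk ⟨h, hh⟩))
    exact ⟨g, hg, hh, by rw [hq, e.apply_symm_apply]⟩

theorem mk_zero_mem_goursatSubgroup {g : G} :
    (g, (0 : H)) ∈ goursatSubgroup e ↔ ∃ hg : g ∈ A, (⟨g, hg⟩ : A) ∈ B := by
  rw [mem_goursatSubgroup]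
  refine exists_congr fun hg => ?_
  have h0 : (QuotientAddGroup.mk ⟨0, C.zero_mem⟩ : C ⧸ D) = 0 := rfl
  simp [h0, C.zero_mem]

theorem zero_mk_mem_goursatSubgroup {h : H} :
    ((0 : G), h) ∈ goursatSubgroup e ↔ ∃ hh : h ∈ C, (⟨h, hh⟩ : C) ∈ D := by
  rw [mem_goursatSubgroup]
  have h0 : (QuotientAddGroup.mk ⟨0, A.zero_mem⟩ : A ⧸ B) = 0 := rfl
  simp only [A.zero_mem, exists_true_left, h0, map_zero]
  refine exists_congr fun hh => ?_
  rw [eq_comm, QuotientAddGroup.eq_zero_iff]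

theorem goursatHom_surjective : Function.Surjective (goursatHom e) := by
  intro q
  obtain ⟨c, rfl⟩ := QuotientAddGroup.mk_surjective q
  refine ⟨(0, -c), ?_⟩
  simp [goursatHom]

/-- The subgroup is a copy of the kernel of a surjection from `A × C` onto `C ⧸ D`. -/
theorem card_goursatSubgroup [Finite G] [Finite H] :
    Nat.card (goursatSubgroup e) = Nat.card A * Nat.card D := by
  have hinj : Function.Injective (A.subtype.prodMap C.subtype) :=
    Function.Injective.prodMap Subtype.val_injective Subtype.val_injective
  have h1 : Nat.card (goursatSubgroup e) = Nat.card (goursatHom e).ker :=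
    AddSubgroup.card_map_of_injective hinj
  have h2 := (goursatHom e).ker.card_mul_index
  rw [AddSubgroup.index_ker, AddMonoidHom.range_eq_top.2 (goursatHom_surjective e),
    AddSubgroup.card_top, Nat.card_prod, AddSubgroup.card_eq_card_quotient_mul_card_addSubgroup D,
    ← h1] at h2
  have hpos : 0 < Nat.card (C ⧸ D) := Nat.card_pos
  refine Nat.eq_of_mul_eq_mul_right hpos ?_
  rw [h2]
  ring

end

variable (G H) in
/-- The data parametrizing subgroups of `G × H` in Goursat's lemma. -/
abbrev GoursatData : Type _ :=
  Σ (A : AddSubgroup G) (B : AddSubgroup A) (C : AddSubgroup H) (D : AddSubgroup C),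
    (A ⧸ B) ≃+ (C ⧸ D)

/-- **Goursat's lemma** as a bijection. -/
theorem goursatSubgroup_bijective :
    Function.Bijective (fun x : GoursatData G H => goursatSubgroup x.2.2.2.2) := by
  constructor
  · rintro ⟨A, B, C, D, e⟩ ⟨A', B', C', D', e'⟩ h
    dsimp only at h
    obtain rfl : A = A' := by
      ext g
      rw [← exists_mem_goursatSubgroup_fst e, ← exists_mem_goursatSubgroup_fst e', h]
    obtain rfl : C = C' := by
      ext g
      rw [← exists_mem_goursatSubgroup_snd e, ← exists_mem_goursatSubgroup_snd e', h]
    obtain rfl : B = B' := by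
      ext ⟨g, hg⟩
      have h1 := mk_zero_mem_goursatSubgroup e (g := g)
      rw [h, mk_zero_mem_goursatSubgroup e'] at h1
      simpa [hg] using h1.symm
    obtain rfl : D = D' := by
      ext ⟨g, hg⟩
      have h1 := zero_mk_mem_goursatSubgroup e (h := g)
      rw [h, zero_mk_mem_goursatSubgroup e'] at h1
      simpa [hg] using h1.symm
    obtain rfl : e = e' := by
      ext q
      obtain ⟨⟨a, ha⟩, rfl⟩ := QuotientAddGroup.mk_surjective q
      obtain ⟨⟨c, hc⟩, hq⟩ := QuotientAddGroup.mk_surjective (e (QuotientAddGroup.mk ⟨a, ha⟩))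
      have hmem : (a, c) ∈ goursatSubgroup e := (mem_goursatSubgroup e).2 ⟨ha, hc, hq.symm⟩
      rw [h] at hmem
      obtain ⟨_, _, h'⟩ := (mem_goursatSubgroup e').1 hmem
      exact hq.symm.trans h'.symm
    rfl
  · intro I
    obtain ⟨A, C, B, D, _, _, e, rfl⟩ := I.goursat
    refine ⟨⟨A, B, C, D, e⟩, ?_⟩
    have hker : (goursatHom e).ker = e.toAddMonoidHom.graph.comap
        ((QuotientAddGroup.mk' B).prodMap (QuotientAddGroup.mk' D)) := by
      ext ⟨a, c⟩
      exact sub_eq_zero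
    dsimp only [goursatSubgroup]
    rw [hker]

noncomputable instance AddSubgroup.fintypeOfFinite (K : Type*) [AddGroup K] [Finite K] :
    Fintype (AddSubgroup K) :=
  Fintype.ofFinite _

theorem finite_addEquiv (K L : Type*) [Add K] [Add L] [Finite K] [Finite L] : Finite (K ≃+ L) :=
  DFunLike.finite _

/-- Summation over the subgroups of `G × H` by means of Goursat's lemma. -/
theorem sum_addSubgroup_prod [Finite G] [Finite H] (f : AddSubgroup (G × H) → ℕ)
    (f' : ∀ A : AddSubgroup G, AddSubgroup A → ∀ C : AddSubgroup H, AddSubgroup C → ℕ)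
    (hf : ∀ (A : AddSubgroup G) (B : AddSubgroup A) (C : AddSubgroup H) (D : AddSubgroup C)
      (e : (A ⧸ B) ≃+ (C ⧸ D)), f (goursatSubgroup e) = f' A B C D) :
    ∑ S, f S = ∑ A : AddSubgroup G, ∑ B : AddSubgroup A, ∑ C : AddSubgroup H,
      ∑ D : AddSubgroup C, Nat.card ((A ⧸ B) ≃+ (C ⧸ D)) * f' A B C D := by
  classical
  let (A : AddSubgroup G) (B : AddSubgroup A) (C : AddSubgroup H) (D : AddSubgroup C) :
      Fintype ((A ⧸ B) ≃+ (C ⧸ D)) :=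
    have := finite_addEquiv (A ⧸ B) (C ⧸ D)
    Fintype.ofFinite _
  rw [← Function.Bijective.sum_comp goursatSubgroup_bijective]
  simp only [Fintype.sum_sigma, hf, Finset.sum_const, Finset.card_univ, smul_eq_mul,
    Nat.card_eq_fintype_card]

theorem card_addSubgroup_prod [Finite G] [Finite H] :
    Nat.card (AddSubgroup (G × H)) = ∑ A : AddSubgroup G, ∑ B : AddSubgroup A,
      ∑ C : AddSubgroup H, ∑ D : AddSubgroup C, Nat.card ((A ⧸ B) ≃+ (C ⧸ D)) := by
  have := sum_addSubgroup_prod (G := G) (H := H) (fun _ => 1) (fun _ _ _ _ => 1)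
    (fun _ _ _ _ _ => rfl)
  simpa [Nat.card_eq_fintype_card] using this

end Goursat

/-! ### Cyclic groups: isomorphisms and subgroups -/

section Cyclic

/-- Fixing one isomorphism identifies all of them with the automorphisms of `ZMod n`, that is, with
its units. -/
theorem card_addEquiv_of_isAddCyclic (K L : Type*) [AddGroup K] [AddGroup L] [Finite K] [Finite L]
    [IsAddCyclic K] [IsAddCyclic L] :
    Nat.card (K ≃+ L) = if Nat.card K = Nat.card L then φ (Nat.card K) else 0 := by
  split_ifs with h
  · let e : K ≃+ L := addEquivOfAddCyclicCardEq h
    let g : ZMod (Nat.card K) ≃+ K := zmodAddCyclicAddEquiv inferInstance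
    have : NeZero (Nat.card K) := ⟨Nat.card_pos.ne'⟩
    rw [← ZMod.card_units_eq_totient, ← Nat.card_eq_fintype_card]
    refine (Nat.card_congr ⟨fun f => (g.trans f).trans (g.trans e).symm,
      fun f => (g.symm.trans f).trans (g.trans e), fun f => ?_, fun f => ?_⟩).trans
      (Nat.card_congr (ZMod.AddAutEquivUnits (Nat.card K)).toEquiv)
    · ext
      simp
    · exact AddEquiv.ext fun x => by simp
  · have : IsEmpty (K ≃+ L) := ⟨fun e => h (Nat.card_congr e.toEquiv)⟩
    exact Nat.card_of_isEmpty

variable {G : Type*} [AddCommGroup G] [Finite G] [IsAddCyclic G]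

/-- By Lagrange `A` lies in the kernel, which in a cyclic group has only `gcd (|G|, |A|)` elements.
-/
theorem AddSubgroup.eq_ker_nsmul_of_isAddCyclic (A : AddSubgroup G) :
    A = (nsmulAddMonoidHom (Nat.card A) : G →+ G).ker := by
  refine AddSubgroup.eq_of_le_of_card_ge ?_ ?_
  · intro g hg
    have : Nat.card A • (⟨g, hg⟩ : A) = 0 := card_nsmul_eq_zero'
    exact congrArg Subtype.val this
  · rw [IsAddCyclic.card_nsmulAddMonoidHom_ker]
    exact Nat.gcd_le_right _ Nat.card_pos

/-- A sum over the subgroups of a cyclic group of order `p ^ a`. -/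
theorem sum_addSubgroup_of_isAddCyclic {p : ℕ} (hp : p.Prime) {a : ℕ} (hG : Nat.card G = p ^ a)
    (f : AddSubgroup G → ℕ) (f' : ℕ × ℕ → ℕ)
    (hf : ∀ (A : AddSubgroup G) (i j : ℕ), Nat.card A = p ^ i → A.index = p ^ j →
      f A = f' (i, j)) :
    ∑ A, f A = ∑ ij ∈ Finset.HasAntidiagonal.antidiagonal a, f' ij := by
  have key : ∀ i j : ℕ, i + j = a →
      Nat.card (nsmulAddMonoidHom (p ^ i) : G →+ G).ker = p ^ i ∧
        (nsmulAddMonoidHom (p ^ i) : G →+ G).ker.index = p ^ j := by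
    intro i j hij
    have h1 : Nat.card (nsmulAddMonoidHom (p ^ i) : G →+ G).ker = p ^ i := by
      rw [IsAddCyclic.card_nsmulAddMonoidHom_ker, hG, Nat.gcd_eq_right]
      exact pow_dvd_pow p (by omega)
    refine ⟨h1, ?_⟩
    have h2 := (nsmulAddMonoidHom (p ^ i) : G →+ G).ker.card_mul_index
    rw [h1, hG, ← hij, pow_add] at h2
    exact Nat.eq_of_mul_eq_mul_left (pow_pos hp.pos i) h2
  symm
  refine Finset.sum_bij (fun ij _ => (nsmulAddMonoidHom (p ^ ij.1) : G →+ G).ker)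
    (fun _ _ => Finset.mem_univ _) ?_ ?_ ?_
  · rintro ⟨i, j⟩ hij ⟨i', j'⟩ hij' h
    rw [Finset.HasAntidiagonal.mem_antidiagonal] at hij hij'
    have h1 := (key i j hij).1
    dsimp only at h hij hij'
    rw [h, (key i' j' hij').1] at h1
    have := Nat.pow_right_injective hp.two_le h1
    simp only [Prod.mk.injEq]
    omega
  · intro A _
    obtain ⟨i, hi, hA⟩ := (Nat.dvd_prime_pow hp).1 (hG ▸ A.card_addSubgroup_dvd_card)
    refine ⟨(i, a - i), Finset.HasAntidiagonal.mem_antidiagonal.2 (by omega), ?_⟩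
    dsimp only
    rw [← hA]
    exact A.eq_ker_nsmul_of_isAddCyclic.symm
  · rintro ⟨i, j⟩ hij
    obtain ⟨h1, h2⟩ := key i j (Finset.HasAntidiagonal.mem_antidiagonal.1 hij)
    exact (hf _ i j h1 h2).symm

end Cyclic

/-! ### Abelian p-groups of rank at most two -/

section RankTwo

/-- The group `K` is isomorphic to `ℤ_{p^u} × ℤ_{p^v}` with `u ≤ v`. -/
def HasType (p u v : ℕ) (K : Type*) [AddCommGroup K] : Prop :=
  u ≤ v ∧ Nonempty (K ≃+ ZMod (p ^ u) × ZMod (p ^ v))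

variable {p : ℕ}

theorem HasType.card {u v : ℕ} {K : Type*} [AddCommGroup K] (h : HasType p u v K) :
    Nat.card K = p ^ (u + v) := by
  obtain ⟨_, ⟨e⟩⟩ := h
  rw [Nat.card_congr e.toEquiv, Nat.card_prod, Nat.card_zmod, Nat.card_zmod, pow_add]

theorem HasType.exponent {u v : ℕ} {K : Type*} [AddCommGroup K] (h : HasType p u v K) :
    AddMonoid.exponent K = p ^ v := by
  obtain ⟨huv, ⟨e⟩⟩ := h
  rw [AddMonoid.exponent_eq_of_addEquiv e, AddMonoid.exponent_prod, ZMod.exponent, ZMod.exponent]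
  exact Nat.lcm_eq_right (pow_dvd_pow p huv)

/-- The order determines `u + v` and the exponent determines `v`. -/
theorem HasType.eq_of_addEquiv (hp : p.Prime) {u v u' v' : ℕ} {K L : Type*} [AddCommGroup K]
    [AddCommGroup L] (h : HasType p u v K) (h' : HasType p u' v' L) (e : K ≃+ L) :
    u = u' ∧ v = v' := by
  have h1 := h.card
  rw [Nat.card_congr e.toEquiv, h'.card] at h1
  have h2 := h.exponent
  rw [AddMonoid.exponent_eq_of_addEquiv e, h'.exponent] at h2
  have h1 := Nat.pow_right_injective hp.two_le h1
  have h2 := Nat.pow_right_injective hp.two_le h2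
  omega

theorem HasType.card_addEquiv (hp : p.Prime) {u v u' v' : ℕ} {K L : Type*} [AddCommGroup K]
    [AddCommGroup L] (h : HasType p u v K) (h' : HasType p u' v' L) :
    Nat.card (K ≃+ L) = if u = u' ∧ v = v' then numAut (p ^ u) (p ^ v) else 0 := by
  split_ifs with heq
  · obtain ⟨rfl, rfl⟩ := heq
    obtain ⟨_, ⟨e⟩⟩ := h
    obtain ⟨_, ⟨e'⟩⟩ := h'
    exact Nat.card_congr
      ⟨fun f => (e.symm.trans f).trans e', fun f => (e.trans f).trans e'.symm,
        fun f => by ext; simp, fun f => by ext <;> simp⟩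
  · have : IsEmpty (K ≃+ L) := ⟨fun e => heq (h.eq_of_addEquiv hp h' e)⟩
    exact Nat.card_of_isEmpty

theorem HasType.congr {u v : ℕ} {K L : Type*} [AddCommGroup K] [AddCommGroup L]
    (h : HasType p u v K) (e : K ≃+ L) : HasType p u v L :=
  ⟨h.1, h.2.map e.symm.trans⟩

theorem card_torsion_congr (n : ℕ) {K L : Type*} [AddCommGroup K] [AddCommGroup L] (e : K ≃+ L) :
    Nat.card (nsmulAddMonoidHom n : K →+ K).ker = Nat.card (nsmulAddMonoidHom n : L →+ L).ker := by
  refine Nat.card_congr (e.toEquiv.subtypeEquiv fun x => ?_)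
  change n • x = 0 ↔ n • e x = 0
  rw [← map_nsmul, EmbeddingLike.map_eq_zero_iff]

theorem card_torsion_pi (n : ℕ) {ι : Type*} [Fintype ι] (K : ι → Type*) [∀ i, AddCommGroup (K i)] :
    Nat.card (nsmulAddMonoidHom n : (∀ i, K i) →+ ∀ i, K i).ker =
      ∏ i, Nat.card (nsmulAddMonoidHom n : K i →+ K i).ker := by
  rw [← Nat.card_pi]
  refine Nat.card_congr ⟨fun x i => ⟨x.1 i, congrFun x.2 i⟩,
    fun x => ⟨fun i => (x i).1, funext fun i => (x i).2⟩, fun _ => rfl, fun _ => rfl⟩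

theorem card_torsion_prod (n : ℕ) (K L : Type*) [AddCommGroup K] [AddCommGroup L] :
    Nat.card (nsmulAddMonoidHom n : K × L →+ K × L).ker =
      Nat.card (nsmulAddMonoidHom n : K →+ K).ker * Nat.card (nsmulAddMonoidHom n : L →+ L).ker := by
  rw [← Nat.card_prod]
  refine Nat.card_congr ⟨fun x => (⟨x.1.1, congrArg Prod.fst x.2⟩, ⟨x.1.2, congrArg Prod.snd x.2⟩),
    fun x => ⟨(x.1.1, x.2.1), Prod.ext x.1.2 x.2.2⟩, fun _ => rfl, fun _ => rfl⟩

theorem card_torsion_addSubgroup_le (n : ℕ) {K : Type*} [AddCommGroup K] [Finite K]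
    (S : AddSubgroup K) :
    Nat.card (nsmulAddMonoidHom n : S →+ S).ker ≤ Nat.card (nsmulAddMonoidHom n : K →+ K).ker :=
  Nat.card_le_card_of_injective
    (fun x => ⟨x.1.1, congrArg Subtype.val x.2⟩ :
      (nsmulAddMonoidHom n : S →+ S).ker → (nsmulAddMonoidHom n : K →+ K).ker)
    fun _ _ h => Subtype.ext (Subtype.ext (Subtype.mk.inj h))

theorem card_torsion_eq_index (n : ℕ) (K : Type*) [AddCommGroup K] [Finite K] :
    Nat.card (nsmulAddMonoidHom n : K →+ K).ker = (nsmulAddMonoidHom n : K →+ K).range.index :=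
  (AddSubgroup.index_range).symm

/-- The `n`-torsion has as many elements as the index of the multiples of `n`, and the index of the
image of a subgroup under a surjection divides the original index. -/
theorem card_torsion_quotient_le (n : ℕ) {K : Type*} [AddCommGroup K] [Finite K]
    (S : AddSubgroup K) :
    Nat.card (nsmulAddMonoidHom n : K ⧸ S →+ K ⧸ S).ker ≤
      Nat.card (nsmulAddMonoidHom n : K →+ K).ker := by
  rw [card_torsion_eq_index, card_torsion_eq_index]
  have hmap : (nsmulAddMonoidHom n : K ⧸ S →+ K ⧸ S).range =
      (nsmulAddMonoidHom n : K →+ K).range.map (QuotientAddGroup.mk' S) := by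
    ext q
    simp only [AddMonoidHom.mem_range, AddSubgroup.mem_map, exists_exists_eq_and]
    constructor
    · rintro ⟨r, rfl⟩
      obtain ⟨k, rfl⟩ := QuotientAddGroup.mk_surjective r
      exact ⟨k, rfl⟩
    · rintro ⟨k, rfl⟩
      exact ⟨QuotientAddGroup.mk k, rfl⟩
  rw [hmap]
  exact Nat.le_of_dvd (Nat.pos_of_ne_zero AddSubgroup.index_ne_zero_of_finite)
    (AddSubgroup.index_map_dvd _ (QuotientAddGroup.mk'_surjective S))

/-- A finite abelian `p`-group whose `p`-torsion has at most `p ^ 2` elements is a product of two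
cyclic groups. -/
theorem exists_hasType (hp : p.Prime) {K : Type*} [AddCommGroup K] {N : ℕ}
    (hK : Nat.card K = p ^ N) (htor : Nat.card (nsmulAddMonoidHom p : K →+ K).ker ≤ p ^ 2) :
    ∃ u v, HasType p u v K := by
  have hfin : Finite K := Nat.finite_of_card_ne_zero (hK ▸ pow_ne_zero N hp.ne_zero)
  obtain ⟨ι, _, n, hn, ⟨e₀⟩⟩ := AddCommGroup.equiv_directSum_zmod_of_finite' K
  have e : K ≃+ ∀ i, ZMod (n i) := e₀.trans (DirectSum.addEquivProd fun i => ZMod (n i))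
  have hcard : ∏ i, n i = p ^ N := by
    rw [← hK, Nat.card_congr e.toEquiv, Nat.card_pi]
    simp
  have hpow : ∀ i, ∃ k, n i = p ^ k := fun i => by
    obtain ⟨k, _, hk⟩ := (Nat.dvd_prime_pow hp).1
      (hcard ▸ Finset.dvd_prod_of_mem n (Finset.mem_univ i))
    exact ⟨k, hk⟩
  choose k hk using hpow
  obtain rfl : n = fun i => p ^ k i := funext hk
  -- Each factor is nontrivial, so it contributes exactly `p` to the order of the `p`-torsion.
  have htor' : p ^ Fintype.card ι ≤ p ^ 2 := by
    refine le_trans (le_of_eq ?_) htor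
    rw [card_torsion_congr p e, card_torsion_pi, ← Finset.card_univ, ← Finset.prod_const]
    refine Finset.prod_congr rfl fun i _ => ?_
    have : NeZero (p ^ k i) := ⟨pow_ne_zero _ hp.ne_zero⟩
    rw [IsAddCyclic.card_nsmulAddMonoidHom_ker, Nat.card_zmod, Nat.gcd_eq_right]
    refine dvd_pow_self p ?_
    rintro h0
    have := hn i
    simp [h0] at this
  have hι : Fintype.card ι ≤ 2 := (Nat.pow_le_pow_iff_right hp.one_lt).1 htor'
  suffices h : ∃ u v, Nonempty (K ≃+ ZMod (p ^ u) × ZMod (p ^ v)) by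
    obtain ⟨u, v, ⟨f⟩⟩ := h
    rcases le_total u v with huv | huv
    · exact ⟨u, v, huv, ⟨f⟩⟩
    · exact ⟨v, u, huv, ⟨f.trans AddEquiv.prodComm⟩⟩
  generalize hm : Fintype.card ι = m at hι
  let g : Fin m ≃ ι := (Fintype.equivFinOfCardEq hm).symm
  have e' : K ≃+ ∀ j : Fin m, ZMod (p ^ k (g j)) := e.trans
    (RingEquiv.piCongrLeft (fun i => ZMod (p ^ k i)) g).symm.toAddEquiv
  have hone : Unique (ZMod (p ^ 0)) := by
    rw [pow_zero]
    exact inferInstanceAs (Unique (Fin 1))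
  -- Missing factors are filled in by the trivial group `ZMod (p ^ 0)`.
  interval_cases m
  · refine ⟨0, 0, ⟨(e'.trans ?_).trans AddEquiv.uniqueProd.symm⟩⟩
    exact AddEquiv.ofUnique
  · refine ⟨0, k (g 0), ⟨(e'.trans ?_).trans AddEquiv.uniqueProd.symm⟩⟩
    exact AddEquiv.piUnique _
  · exact ⟨k (g 0), k (g 1), ⟨e'.trans (RingEquiv.piFinTwo _).toAddEquiv⟩⟩

theorem hasType_of_card_exponent (hp : p.Prime) {K : Type*} [AddCommGroup K] {u v : ℕ}
    (hcard : Nat.card K = p ^ (u + v)) (hexp : AddMonoid.exponent K = p ^ v)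
    (htor : Nat.card (nsmulAddMonoidHom p : K →+ K).ker ≤ p ^ 2) : HasType p u v K := by
  obtain ⟨u', v', h⟩ := exists_hasType hp hcard htor
  have h1 := h.card
  rw [hcard] at h1
  have h2 := h.exponent
  rw [hexp] at h2
  have h1 := Nat.pow_right_injective hp.two_le h1
  obtain rfl := Nat.pow_right_injective hp.two_le h2
  obtain rfl : u = u' := by omega
  exact h

end RankTwo

/-! ### Types of subgroups and quotients of a product of two cyclic groups -/

section CyclicProduct

variable {p : ℕ} {G H : Type*} [AddCommGroup G] [AddCommGroup H] [Finite G] [Finite H]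
  [IsAddCyclic G] [IsAddCyclic H]

theorem card_torsion_prod_le_of_isAddCyclic (hp : p.Prime) :
    Nat.card (nsmulAddMonoidHom p : G × H →+ G × H).ker ≤ p ^ 2 := by
  rw [card_torsion_prod, IsAddCyclic.card_nsmulAddMonoidHom_ker,
    IsAddCyclic.card_nsmulAddMonoidHom_ker, sq]
  exact Nat.mul_le_mul (Nat.gcd_le_right _ hp.pos) (Nat.gcd_le_right _ hp.pos)

theorem IsAddCyclic.card_dvd_iff_forall_nsmul_eq_zero {K : Type*} [AddCommGroup K] [IsAddCyclic K]
    {n : ℕ} : Nat.card K ∣ n ↔ ∀ k : K, n • k = 0 := by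
  rw [← IsAddCyclic.exponent_eq_card, AddMonoid.exponent_dvd_iff_forall_nsmul_eq_zero]

theorem IsAddCyclic.index_dvd_iff_forall_nsmul_mem {K : Type*} [AddCommGroup K] [IsAddCyclic K]
    {B : AddSubgroup K} {n : ℕ} : B.index ∣ n ↔ ∀ k : K, n • k ∈ B := by
  have : IsAddCyclic (K ⧸ B) :=
    isAddCyclic_of_surjective (QuotientAddGroup.mk' B) (QuotientAddGroup.mk'_surjective B)
  rw [AddSubgroup.index, IsAddCyclic.card_dvd_iff_forall_nsmul_eq_zero,
    (QuotientAddGroup.mk_surjective (s := B)).forall]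
  refine forall_congr' fun k => ?_
  rw [← QuotientAddGroup.mk_nsmul, QuotientAddGroup.eq_zero_iff]

variable {A : AddSubgroup G} {B : AddSubgroup A} {C : AddSubgroup H} {D : AddSubgroup C}
  (e : (A ⧸ B) ≃+ (C ⧸ D))

omit [Finite G] [Finite H] in
-- A multiple `n` annihilates the subgroup exactly when it annihilates both projections, which are
-- the cyclic groups `A` and `C`.
theorem exponent_goursatSubgroup :
    AddMonoid.exponent (goursatSubgroup e) = (Nat.card A).lcm (Nat.card C) := by
  refine (Nat.dvd_right_iff_eq.1 fun n => ?_)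
  rw [AddMonoid.exponent_dvd_iff_forall_nsmul_eq_zero, Nat.lcm_dvd_iff,
    IsAddCyclic.card_dvd_iff_forall_nsmul_eq_zero, IsAddCyclic.card_dvd_iff_forall_nsmul_eq_zero]
  constructor
  · intro h
    constructor
    · rintro ⟨a, ha⟩
      obtain ⟨c, hc⟩ := (exists_mem_goursatSubgroup_fst e).2 ha
      exact Subtype.ext (congrArg (fun s => s.1.1) (h ⟨(a, c), hc⟩))
    · rintro ⟨c, hc⟩
      obtain ⟨a, ha⟩ := (exists_mem_goursatSubgroup_snd e).2 hc
      exact Subtype.ext (congrArg (fun s => s.1.2) (h ⟨(a, c), ha⟩))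
  · rintro ⟨hA, hC⟩ ⟨⟨a, c⟩, hac⟩
    have ha := (exists_mem_goursatSubgroup_fst e).1 ⟨c, hac⟩
    have hc := (exists_mem_goursatSubgroup_snd e).1 ⟨a, hac⟩
    exact Subtype.ext (Prod.ext (congrArg Subtype.val (hA ⟨a, ha⟩))
      (congrArg Subtype.val (hC ⟨c, hc⟩)))

omit [Finite G] [Finite H] in
-- A multiple `n` annihilates the quotient exactly when it sends each axis into the subgroup, that
-- is, `G` into `B` and `H` into `D`; by cyclicity this means that both indices divide `n`.
theorem exponent_quotient_goursatSubgroup :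
    AddMonoid.exponent ((G × H) ⧸ goursatSubgroup e) =
      (B.index * A.index).lcm (D.index * C.index) := by
  have hB : (B.map A.subtype).index = B.index * A.index := by
    rw [AddSubgroup.index_map_subtype]
  have hD : (D.map C.subtype).index = D.index * C.index := by
    rw [AddSubgroup.index_map_subtype]
  refine (Nat.dvd_right_iff_eq.1 fun n => ?_)
  rw [AddMonoid.exponent_dvd_iff_forall_nsmul_eq_zero, Nat.lcm_dvd_iff, ← hB, ← hD,
    IsAddCyclic.index_dvd_iff_forall_nsmul_mem, IsAddCyclic.index_dvd_iff_forall_nsmul_mem,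
    (QuotientAddGroup.mk_surjective (s := goursatSubgroup e)).forall]
  simp only [← QuotientAddGroup.mk_nsmul, QuotientAddGroup.eq_zero_iff]
  have h1 : ∀ g : G, (g, (0 : H)) ∈ goursatSubgroup e ↔ g ∈ B.map A.subtype := fun g => by
    rw [mk_zero_mem_goursatSubgroup]
    simp
  have h2 : ∀ h : H, ((0 : G), h) ∈ goursatSubgroup e ↔ h ∈ D.map C.subtype := fun g => by
    rw [zero_mk_mem_goursatSubgroup]
    simp
  constructor
  · refine fun h => ⟨fun g => (h1 _).1 ?_, fun g => (h2 _).1 ?_⟩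
    · simpa using h (g, 0)
    · simpa using h (0, g)
  · rintro ⟨hG, hH⟩ ⟨g, h⟩
    simpa using add_mem ((h1 _).2 (hG g)) ((h2 _).2 (hH h))

theorem Nat.lcm_prime_pow (p i j : ℕ) : (p ^ i).lcm (p ^ j) = p ^ max i j := by
  rcases le_total i j with h | h
  · rw [Nat.lcm_eq_right (pow_dvd_pow p h), max_eq_right h]
  · rw [Nat.lcm_eq_left (pow_dvd_pow p h), max_eq_left h]

variable {x : Quint} (hB : Nat.card B = p ^ x.c₁) (hA' : A.index = p ^ x.c₂)
  (hB' : B.index = p ^ x.c₃) (hD' : D.index = p ^ x.c₃) (hD : Nat.card D = p ^ x.c₄)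
  (hC' : C.index = p ^ x.c₅)

include hB hB' hD hD' in
theorem hasType_goursatSubgroup (hp : p.Prime) :
    HasType p (min x.c₁ x.c₄) (x.c₃ + max x.c₁ x.c₄) (goursatSubgroup e) := by
  have hA : Nat.card A = p ^ (x.c₁ + x.c₃) := by rw [← B.card_mul_index, hB, hB', pow_add]
  have hC : Nat.card C = p ^ (x.c₄ + x.c₃) := by rw [← D.card_mul_index, hD, hD', pow_add]
  refine hasType_of_card_exponent hp ?_ ?_
    ((card_torsion_addSubgroup_le p _).trans (card_torsion_prod_le_of_isAddCyclic hp))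
  · rw [card_goursatSubgroup, hA, hD, ← pow_add]
    congr 1
    omega
  · rw [exponent_goursatSubgroup, hA, hC, Nat.lcm_prime_pow]
    congr 1
    omega

include hB hB' hD hD' hA' hC' in
theorem hasType_quotient_goursatSubgroup (hp : p.Prime) :
    HasType p (min x.c₂ x.c₅) (x.c₃ + max x.c₂ x.c₅) ((G × H) ⧸ goursatSubgroup e) := by
  have hA : Nat.card A = p ^ (x.c₁ + x.c₃) := by rw [← B.card_mul_index, hB, hB', pow_add]
  have hC : Nat.card C = p ^ (x.c₄ + x.c₃) := by rw [← D.card_mul_index, hD, hD', pow_add]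
  refine hasType_of_card_exponent hp ?_ ?_
    ((card_torsion_quotient_le p _).trans (card_torsion_prod_le_of_isAddCyclic hp))
  · have h := (goursatSubgroup e).card_mul_index
    rw [card_goursatSubgroup, Nat.card_prod, ← A.card_mul_index, ← C.card_mul_index, hA, hD, hA',
      hC, hC'] at h
    refine Nat.eq_of_mul_eq_mul_left (pow_pos hp.pos (x.c₁ + x.c₃ + x.c₄)) ?_
    rw [pow_add p (x.c₁ + x.c₃)]
    refine h.trans ?_
    simp only [← pow_add]
    congr 1
    omega
  · rw [exponent_quotient_goursatSubgroup, hA', hB', hC', hD', ← pow_add, ← pow_add,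
      Nat.lcm_prime_pow]
    congr 1
    omega

end CyclicProduct

/-! ### Quintuples of exponents -/

section Quint

/-- The quintuples parametrizing the subgroups of `ℤ_{p^a} × ℤ_{p^b}`. -/
def Quint.finset (a b : ℕ) : Finset Quint :=
  ((Finset.range (a + 1) ×ˢ Finset.range (a + 1) ×ˢ Finset.range (a + 1) ×ˢ
    Finset.range (b + 1) ×ˢ Finset.range (b + 1)).filter fun q =>
      q.1 + q.2.1 + q.2.2.1 = a ∧ q.2.2.1 + q.2.2.2.1 + q.2.2.2.2 = b).map
    ⟨fun q => ⟨q.1, q.2.1, q.2.2.1, q.2.2.2.1, q.2.2.2.2⟩, by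
      rintro ⟨_, _, _, _, _⟩ ⟨_, _, _, _, _⟩ h
      simpa using h⟩

theorem Quint.mem_finset {a b : ℕ} {x : Quint} :
    x ∈ Quint.finset a b ↔ x.c₁ + x.c₂ + x.c₃ = a ∧ x.c₃ + x.c₄ + x.c₅ = b := by
  simp only [Quint.finset, Finset.mem_map, Finset.mem_filter, Finset.mem_product,
    Finset.mem_range, Prod.exists]
  constructor
  · rintro ⟨_, _, _, _, _, ⟨_, h⟩, rfl⟩
    exact h
  · intro h
    exact ⟨x.c₁, x.c₂, x.c₃, x.c₄, x.c₅, ⟨by omega, h⟩, rfl⟩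

open Finset.HasAntidiagonal in
-- The left side runs over the exponents of orders and indices in two chains; the condition that the
-- middle indices agree merges them into the single entry `c₃`.
theorem Quint.sum_antidiagonal_ite (a b : ℕ) (w : ℕ → ℕ) (f : Quint → ℕ) :
    ∑ ij ∈ antidiagonal a, ∑ kl ∈ antidiagonal ij.1, ∑ ij' ∈ antidiagonal b,
      ∑ kl' ∈ antidiagonal ij'.1,
        (if kl.2 = kl'.2 then w kl.2 else 0) * f ⟨kl.1, ij.2, kl.2, kl'.1, ij'.2⟩ =
      ∑ x ∈ Quint.finset a b, w x.c₃ * f x := by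
  simp only [Finset.sum_sigma']
  symm
  refine Finset.sum_of_injOn
    (fun x => ⟨(x.c₁ + x.c₃, x.c₂), (x.c₁, x.c₃), (x.c₄ + x.c₃, x.c₅), (x.c₄, x.c₃)⟩)
    ?_ ?_ ?_ ?_
  · intro x _ y _ h
    simp only [Sigma.mk.injEq, Prod.mk.injEq, heq_eq_eq] at h
    ext <;> omega
  · intro x hx
    have := Quint.mem_finset.1 hx
    simp only [SetLike.mem_coe, Finset.mem_sigma, mem_antidiagonal]
    exact ⟨by omega, trivial, by omega, trivial⟩
  · rintro ⟨⟨i, j⟩, ⟨k, l⟩, ⟨i', j'⟩, ⟨k', l'⟩⟩ hmem hnot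
    simp only [Finset.mem_sigma, mem_antidiagonal] at hmem
    simp only [mul_eq_zero, ite_eq_right_iff]
    left
    rintro rfl
    exfalso
    refine hnot ⟨⟨k, j, l, k', j'⟩, Quint.mem_finset.2 (by dsimp only; omega), ?_⟩
    obtain ⟨_, rfl, _, rfl⟩ := hmem
    rfl
  · intro x _
    simp

end Quint

/-! ### Summing over subgroups of a product of two cyclic p-groups -/

section Count

variable {p : ℕ} {G H : Type*} [AddCommGroup G] [AddCommGroup H] [Finite G] [Finite H]
  [IsAddCyclic G] [IsAddCyclic H]

theorem Nat.eq_prime_pow_log_of_dvd (hp : p.Prime) {n a : ℕ} (h : n ∣ p ^ a) :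
    n = p ^ Nat.log p n := by
  obtain ⟨k, _, rfl⟩ := (Nat.dvd_prime_pow hp).1 h
  rw [Nat.log_pow hp.one_lt]

/-- Summation over the subgroups of a product of two cyclic `p`-groups. -/
theorem sum_addSubgroup_prod_of_isAddCyclic (hp : p.Prime) {a b : ℕ} (hG : Nat.card G = p ^ a)
    (hH : Nat.card H = p ^ b) (f : AddSubgroup (G × H) → ℕ) (f' : Quint → ℕ)
    (hf : ∀ (A : AddSubgroup G) (B : AddSubgroup A) (C : AddSubgroup H) (D : AddSubgroup C)
      (e : (A ⧸ B) ≃+ (C ⧸ D)) (x : Quint), Nat.card B = p ^ x.c₁ → A.index = p ^ x.c₂ →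
        B.index = p ^ x.c₃ → D.index = p ^ x.c₃ → Nat.card D = p ^ x.c₄ → C.index = p ^ x.c₅ →
          f (goursatSubgroup e) = f' x) :
    ∑ S, f S = ∑ x ∈ Quint.finset a b, φ (p ^ x.c₃) * f' x := by
  -- All orders and indices here are powers of `p`, so `Nat.log p` recovers their exponents exactly.
  rw [← Quint.sum_antidiagonal_ite a b (fun i => φ (p ^ i)), sum_addSubgroup_prod f
    (fun A B C D => f' ⟨Nat.log p (Nat.card B), Nat.log p A.index, Nat.log p B.index,
      Nat.log p (Nat.card D), Nat.log p C.index⟩)]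
  · refine sum_addSubgroup_of_isAddCyclic hp hG _ _ fun A i j hA hA' => ?_
    refine sum_addSubgroup_of_isAddCyclic hp hA _ _ fun B k l hB hB' => ?_
    refine sum_addSubgroup_of_isAddCyclic hp hH _ _ fun C i' j' hC hC' => ?_
    refine sum_addSubgroup_of_isAddCyclic hp hC _ _ fun D k' l' hD hD' => ?_
    have : IsAddCyclic (A ⧸ B) :=
      isAddCyclic_of_surjective (QuotientAddGroup.mk' B) (QuotientAddGroup.mk'_surjective B)
    have : IsAddCyclic (C ⧸ D) :=
      isAddCyclic_of_surjective (QuotientAddGroup.mk' D) (QuotientAddGroup.mk'_surjective D)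
    rw [card_addEquiv_of_isAddCyclic]
    change (if B.index = D.index then φ B.index else 0) * _ = _
    simp only [hA', hB, hB', hC', hD, hD', Nat.log_pow hp.one_lt,
      (Nat.pow_right_injective hp.two_le).eq_iff]
  · intro A B C D e
    have hA := A.card_addSubgroup_dvd_card
    have hA' := A.index_dvd_card
    have hB := B.card_addSubgroup_dvd_card.trans hA
    have hB' := B.index_dvd_card.trans hA
    have hC := C.card_addSubgroup_dvd_card
    have hC' := C.index_dvd_card
    have hD := D.card_addSubgroup_dvd_card.trans hC
    rw [hG] at hA' hB hB'
    rw [hH] at hC' hD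
    -- The isomorphism `e` forces equal indices, so `c₃` serves for both `B` and `D`.
    have hBD : D.index = B.index := (Nat.card_congr e.toEquiv).symm
    refine hf A B C D e _ ?_ ?_ ?_ (hBD.trans ?_) ?_ ?_ <;>
      exact Nat.eq_prime_pow_log_of_dvd hp ‹_›

end Count

/-! ### Summing over subgroups by isomorphism type -/

section Iterate

variable {p : ℕ} {K : Type*} [AddCommGroup K] [Finite K] {a b : ℕ}

/-- A sum over the subgroups of `ℤ_{p^a} × ℤ_{p^b}` of a function of their isomorphism type. -/
theorem sum_addSubgroup_of_hasType (hp : p.Prime) (e : K ≃+ ZMod (p ^ a) × ZMod (p ^ b))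
    (f : AddSubgroup K → ℕ) (F : ℕ → ℕ → ℕ)
    (hf : ∀ (S : AddSubgroup K) (u v : ℕ), HasType p u v S → f S = F u v) :
    ∑ S, f S = ∑ x ∈ Quint.finset a b,
      φ (p ^ x.c₃) * F (min x.c₁ x.c₄) (x.c₃ + max x.c₁ x.c₄) := by
  have (n : ℕ) : NeZero (p ^ n) := ⟨pow_ne_zero n hp.ne_zero⟩
  rw [← e.symm.mapAddSubgroup.toEquiv.sum_comp]
  refine sum_addSubgroup_prod_of_isAddCyclic hp (Nat.card_zmod _) (Nat.card_zmod _) _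
    (fun x => F (min x.c₁ x.c₄) (x.c₃ + max x.c₁ x.c₄)) ?_
  intro A B C D g x hB _ hB' hD' hD _
  exact hf _ _ _ ((hasType_goursatSubgroup g hB hB' hD' hD hp).congr
    (e.symm.addSubgroupMap (goursatSubgroup g)))

/-- A sum over the subgroups of `ℤ_{p^a} × ℤ_{p^b}` of a function of the isomorphism type of the
quotient. -/
theorem sum_addSubgroup_of_hasType_quotient (hp : p.Prime) (e : K ≃+ ZMod (p ^ a) × ZMod (p ^ b))
    (f : AddSubgroup K → ℕ) (F : ℕ → ℕ → ℕ)
    (hf : ∀ (S : AddSubgroup K) (u v : ℕ), HasType p u v (K ⧸ S) → f S = F u v) :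
    ∑ S, f S = ∑ x ∈ Quint.finset a b,
      φ (p ^ x.c₃) * F (min x.c₂ x.c₅) (x.c₃ + max x.c₂ x.c₅) := by
  have (n : ℕ) : NeZero (p ^ n) := ⟨pow_ne_zero n hp.ne_zero⟩
  rw [← e.symm.mapAddSubgroup.toEquiv.sum_comp]
  refine sum_addSubgroup_prod_of_isAddCyclic hp (Nat.card_zmod _) (Nat.card_zmod _) _
    (fun x => F (min x.c₂ x.c₅) (x.c₃ + max x.c₂ x.c₅)) ?_
  intro A B C D g x hB hA' hB' hD' hD hC'
  exact hf _ _ _ ((hasType_quotient_goursatSubgroup g hB hA' hB' hD' hD hC' hp).congr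
    (QuotientAddGroup.congr (goursatSubgroup g) _ e.symm rfl))

end Iterate

/-! ### Assembling the sum over 20-tuples -/

/-- The quadruples of quintuples satisfying all the admissibility conditions except the last two. -/
def Quint.quadruples (a b c d : ℕ) : Finset (Σ (_ : Quint) (_ : Quint) (_ : Quint), Quint) :=
  (Quint.finset a b).sigma fun x =>
    (Quint.finset (min x.c₁ x.c₄) (x.c₃ + max x.c₁ x.c₄)).sigma fun _ =>
      (Quint.finset c d).sigma fun z => Quint.finset (min z.c₁ z.c₄) (z.c₃ + max z.c₁ z.c₄)

theorem injective_toSigma : Function.Injective (fun q : Quint × Quint × Quint × Quint =>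
    (⟨q.1, q.2.1, q.2.2.1, q.2.2.2⟩ : Σ (_ : Quint) (_ : Quint) (_ : Quint), Quint)) := by
  rintro ⟨x, y, z, t⟩ ⟨x', y', z', t'⟩ h
  simpa using h

theorem toSigma_mem_quadruples {a b c d : ℕ} {q : Quint × Quint × Quint × Quint}
    (hq : q ∈ admissibleTuples a b c d) :
    (⟨q.1, q.2.1, q.2.2.1, q.2.2.2⟩ : Σ (_ : Quint) (_ : Quint) (_ : Quint), Quint) ∈
      Quint.quadruples a b c d := by
  simp only [Quint.quadruples, Finset.mem_sigma, Quint.mem_finset]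
  obtain ⟨h1, h2, h3, h4, h5, h6, h7, h8, -⟩ := hq
  exact ⟨⟨h1, h2⟩, ⟨h3, h4⟩, ⟨h5, h6⟩, h7, h8⟩

theorem finite_admissibleTuples (a b c d : ℕ) : (admissibleTuples a b c d).Finite :=
  Set.Finite.of_injOn (fun _ hq => toSigma_mem_quadruples hq) injective_toSigma.injOn
    (Quint.quadruples a b c d).finite_toSet

/-- The number of pairs of a subquotient of `ℤ_{p^c} × ℤ_{p^d}` and an isomorphism of it with
`ℤ_{p^u} × ℤ_{p^v}`, as a sum over quintuples. -/
noncomputable def subquotientIsoSum (p c d u v : ℕ) : ℕ :=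
  ∑ z ∈ Quint.finset c d, φ (p ^ z.c₃) *
    ∑ t ∈ Quint.finset (min z.c₁ z.c₄) (z.c₃ + max z.c₁ z.c₄), φ (p ^ t.c₃) *
      if u = min t.c₂ t.c₅ ∧ v = t.c₃ + max t.c₂ t.c₅ then numAut (p ^ u) (p ^ v) else 0

/-- The inner sum depends only on the type of `C`, and its terms only on the type of `C ⧸ D`, so the
two summation formulas apply in turn and yield `z` and `t`. -/
theorem sum_card_addEquiv_subquotient {p : ℕ} (hp : p.Prime) {c d u v : ℕ} {Q L : Type*}
    [AddCommGroup Q] [AddCommGroup L] [Finite L] (hQ : HasType p u v Q)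
    (e : L ≃+ ZMod (p ^ c) × ZMod (p ^ d)) :
    ∑ C : AddSubgroup L, ∑ D : AddSubgroup C, Nat.card (Q ≃+ (C ⧸ D)) =
      subquotientIsoSum p c d u v := by
  refine sum_addSubgroup_of_hasType hp e _
    (fun u' v' => ∑ t ∈ Quint.finset u' v', φ (p ^ t.c₃) *
      if u = min t.c₂ t.c₅ ∧ v = t.c₃ + max t.c₂ t.c₅ then
        numAut (p ^ u) (p ^ v) else 0) fun C u' v' hC => ?_
  obtain ⟨eC⟩ := hC.2
  exact sum_addSubgroup_of_hasType_quotient hp eC _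
    (fun u' v' => if u = u' ∧ v = v' then numAut (p ^ u) (p ^ v) else 0)
    fun D u' v' hD => hQ.card_addEquiv hp hD

/-- The nested sum ranges over tuples satisfying the first eight conditions; the `if` in
`subquotientIsoSum` kills those failing one of the last two. -/
theorem finsum_admissibleTuples (p a b c d : ℕ) :
    ∑ᶠ q ∈ admissibleTuples a b c d, summand p q.1 q.2.1 q.2.2.1 q.2.2.2 =
      ∑ x ∈ Quint.finset a b, φ (p ^ x.c₃) *
        ∑ y ∈ Quint.finset (min x.c₁ x.c₄) (x.c₃ + max x.c₁ x.c₄), φ (p ^ y.c₃) *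
          subquotientIsoSum p c d (min y.c₂ y.c₅) (y.c₃ + max y.c₂ y.c₅) := by
  rw [finsum_mem_eq_finite_toFinset_sum _ (finite_admissibleTuples a b c d)]
  simp only [subquotientIsoSum, Finset.mul_sum]
  simp only [Finset.sum_sigma']
  refine Finset.sum_of_injOn
    (fun q => ⟨q.1, q.2.1, q.2.2.1, q.2.2.2⟩) injective_toSigma.injOn ?_ ?_ ?_
  · intro q hq
    exact toSigma_mem_quadruples (by simpa using hq)
  · rintro ⟨x, y, z, t⟩ hmem hnot
    simp only [Finset.mem_sigma, Quint.mem_finset] at hmem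
    obtain ⟨⟨h1, h2⟩, ⟨h3, h4⟩, ⟨h5, h6⟩, h7, h8⟩ := hmem
    dsimp only
    rw [if_neg]
    · simp
    · rintro ⟨h9, h10⟩
      refine hnot ⟨(x, y, z, t), ?_, rfl⟩
      rw [Set.Finite.coe_toFinset]
      exact ⟨h1, h2, h3, h4, h5, h6, h7, h8, h9, h10⟩
  · intro q hq
    rw [Set.Finite.mem_toFinset] at hq
    obtain ⟨-, -, -, -, -, -, -, -, h9, h10⟩ := hq
    dsimp only
    rw [if_pos ⟨h9, h10⟩, summand]
    ring

theorem mainTheorem7 (p : ℕ) (hp : p.Prime) (a b c d : ℕ) :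
    (admissibleTuples a b c d).Finite ∧
      numSubgroups (p ^ a) (p ^ b) (p ^ c) (p ^ d) =
        ∑ᶠ q ∈ admissibleTuples a b c d, summand p q.1 q.2.1 q.2.2.1 q.2.2.2 := by
  refine ⟨finite_admissibleTuples a b c d, ?_⟩
  have (n : ℕ) : NeZero (p ^ n) := ⟨pow_ne_zero n hp.ne_zero⟩
  let e : ZMod (p ^ a) × ZMod (p ^ b) × ZMod (p ^ c) × ZMod (p ^ d) ≃+
      (ZMod (p ^ a) × ZMod (p ^ b)) × (ZMod (p ^ c) × ZMod (p ^ d)) := AddEquiv.prodAssoc.symm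
  rw [finsum_admissibleTuples, numSubgroups, Nat.card_congr e.mapAddSubgroup.toEquiv,
    card_addSubgroup_prod]
  -- The type of `A` produces `x`; then the type of `A ⧸ B` produces `y` and fixes the `(u, v)` to
  -- be matched on the other side.
  refine sum_addSubgroup_of_hasType hp (AddEquiv.refl _) _
    (fun u v => ∑ y ∈ Quint.finset u v, φ (p ^ y.c₃) *
      subquotientIsoSum p c d (min y.c₂ y.c₅) (y.c₃ + max y.c₂ y.c₅)) fun A u v hA => ?_
  obtain ⟨eA⟩ := hA.2
  exact sum_addSubgroup_of_hasType_quotient hp eA _ (subquotientIsoSum p c d)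
    fun B u v hB => sum_card_addEquiv_subquotient hp hB (AddEquiv.refl _)
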